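/- Let $k>0$, let $f(z)=z-k/\sin\overline z$, and let $J$ be the Jacobian determinant of $f$ as a map of the real plane. Let $D^-$ be the set of all $z$ with $|\operatorname{Re} z|<\pi/2$ for which $z=0$ (the pole of $f$, where $J$ tends to $-\infty$) or $J(z)<0$. Then the boundary $\partial D^-$ in $\mathbb{C}$ is a union of finitely many disjoint Jordan curves, which can be oriented so that $D^-$ stays on the left (that is, their total winding number is $1$ about each point of $D^-$ and $0$ about each point outside its closure). For every $w\in\mathbb{C}\setminus f(\partial D^-)$, the winding number $I_w(f(\partial D^-))$, i.e. the sum of the winding numbers about $w$ of the images under $f$ of these closed curves, satisfies $$|I_w(f(\partial D^-))|\le 2 .$$ -/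

import Mathlib

/-- The harmonic map `f(z) = z - k / sin (conj z)`, i.e. `f(z) = z + conj (g z)` with
`g(z) = -k / sin z`. Its only pole in the strip `|Re z| ≤ π/2` is `0`. -/
noncomputable def lensMap (k : ℝ) (z : ℂ) : ℂ :=
  z - (k : ℂ) / Complex.sin (starRingEnd ℂ z)

/-- The Jacobian determinant of the lens map, as a map of the real plane (at points other than
poles of the map). -/
noncomputable def lensJacobian (k : ℝ) (z : ℂ) : ℝ :=
  (fderiv ℝ (lensMap k) z).det

/-- The set `D⁻`: the part of the open strip `|Re z| < π/2` where the Jacobian is negative.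
The pole `0`, where the Jacobian tends to `-∞`, belongs to it. -/
def negRegion (k : ℝ) : Set ℂ :=
  {z : ℂ | |z.re| < Real.pi / 2 ∧ (z = 0 ∨ lensJacobian k z < 0)}

/-- The closed curve `c`, parametrized by the unit circle, has winding number `n` about `w`:
along `t ↦ c (e ^ (i t))` there is a continuous branch `L` of `log (c - w)`, and it increases by
`2 π i n` over one period. In particular `c` does not pass through `w`. -/
def HasWindingNumber (c : Circle → ℂ) (w : ℂ) (n : ℤ) : Prop :=
  ∃ L : ℝ → ℂ, Continuous L ∧
    (∀ t : ℝ, Complex.exp (L t) = c (Circle.exp t) - w) ∧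
    L (2 * Real.pi) - L 0 = 2 * (Real.pi : ℂ) * Complex.I * (n : ℂ)

/-- A finite family of closed curves has total winding number `N` about `w`: every curve of the
family has a winding number about `w`, and these add up to `N`. -/
def HasTotalWindingNumber {m : ℕ} (c : Fin m → Circle → ℂ) (w : ℂ) (N : ℤ) : Prop :=
  ∃ n : Fin m → ℤ, (∀ i, HasWindingNumber (c i) w (n i)) ∧ ∑ i, n i = N

/-- The closed curves `c i` parametrize the boundary of the bounded open set `D`: they are
pairwise disjoint Jordan curves whose union is the boundary of `D`, oriented so that `D` stays on
the left, that is, their total winding number is `1` about every point of `D` and `0` about every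
point outside the closure of `D`. -/
structure IsOrientedBoundary (D : Set ℂ) {m : ℕ} (c : Fin m → Circle → ℂ) : Prop where
  continuous : ∀ i, Continuous (c i)
  injective : ∀ i, Function.Injective (c i)
  disjoint : ∀ i j, i ≠ j → Disjoint (Set.range (c i)) (Set.range (c j))
  union : ⋃ i, Set.range (c i) = frontier D
  inside : ∀ z ∈ D, HasTotalWindingNumber c z 1
  outside : ∀ z ∉ closure D, HasTotalWindingNumber c z 0

/-! ### Winding numbers through continuous logarithms. -/

section Winding

open Complex

/-! Write `z = x + iy` and `r = |cos z|`. Inside the strip, `J = 0` means `|sin z|² = k r`. Adding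
and subtracting this and `|cos z|² = r²` gives `2 sinh² y = r² + k r - 1` and `2 cos² x = r² - k r +
1`, so `|y|` determines `r` and then `|x|`. Hence `D⁻` is `|x| < halfWidth k y`, and its boundary is
a single Jordan curve, symmetric in both axes. For large `k` parts of it run along `|x| = π/2`.

On the boundary `Im f = y - cos x sinh y / r`, which for `y ≥ 0` is the function `profile k` of `r`
alone. It is nonnegative and first increases, then decreases (`profile_unimodal`); the lower half of
the curve is mirrored by conjugation. If `Im w ≥ 0`, the level `Im w` therefore cuts the parameter
circle into at most five arcs, on each of which the image stays on one side of the horizontal line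
through `w`. The argument changes by at most `π` on each, so `2π|n| ≤ 5π` and `|n| ≤ 2`.

An arbitrary oriented family of boundary curves factors through this Jordan curve with degrees of
sum `1`, so its image has the same total winding number. -/

theorem exists_continuous_exp_eq {c : ℝ → ℂ} (hc : Continuous c) (h0 : ∀ t, c t ≠ 0) :
    ∃ L : ℝ → ℂ, Continuous L ∧ ∀ t, exp (L t) = c t := by
  obtain ⟨F, ⟨-, hF⟩, -⟩ := Complex.isCoveringMapOn_exp.existsUnique_continuousMap_lifts
    (⟨c, hc⟩ : C(ℝ, ℂ)) (a₀ := 0) (e₀ := log (c 0)) (by simp [exp_log (h0 0)])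
    (fun t => by simpa using h0 t)
  exact ⟨F, F.continuous, fun t => congrFun hF t⟩

theorem sub_eq_sub_of_exp_eq {L M : ℝ → ℂ} (hL : Continuous L) (hM : Continuous M)
    (h : ∀ t, exp (L t) = exp (M t)) (s t : ℝ) : L t - M t = L s - M s := by
  have hu := (Complex.isCoveringMapOn_exp.existsUnique_continuousMap_lifts
    (⟨fun t => exp (L t), by fun_prop⟩ : C(ℝ, ℂ)) (a₀ := s) (e₀ := L s) (by simp)
    (fun t => by simp [exp_ne_zero])).unique
    (y₁ := ⟨L, hL⟩) (y₂ := ⟨fun t => M t + (L s - M s), by fun_prop⟩)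
    ⟨rfl, by ext; simp⟩ ⟨by simp, by
      ext t
      have : exp (L s - M s) = 1 := by rw [exp_sub, h s, div_self (exp_ne_zero _)]
      simp [exp_add, this, h t]⟩
  have := congrArg (fun f : C(ℝ, ℂ) => f t) hu
  simp only [ContinuousMap.coe_mk] at this
  rw [this]; ring

theorem circleExp_add_two_pi_mul_int (t : ℝ) (m : ℤ) :
    Circle.exp (t + 2 * Real.pi * m) = Circle.exp t := by
  have := (Circle.periodic_exp).int_mul m t
  rw [← this]; congr 1; ring

theorem exists_hasWindingNumber {c : Circle → ℂ} (hc : Continuous c) {w : ℂ}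
    (hw : ∀ x, c x ≠ w) : ∃ n, HasWindingNumber c w n := by
  obtain ⟨L, hL, h⟩ := exists_continuous_exp_eq (c := fun t => c (Circle.exp t) - w)
    (by fun_prop) (fun t => sub_ne_zero.2 (hw _))
  have : exp (L (2 * Real.pi)) = exp (L 0) := by
    rw [h, h, Circle.exp_two_pi, Circle.exp_zero]
  obtain ⟨n, hn⟩ := exp_eq_exp_iff_exists_int.1 this
  exact ⟨n, L, hL, h, by rw [hn]; ring⟩

theorem lift_add_two_pi_mul_int {c : Circle → ℂ} {w : ℂ} {n : ℤ} {L : ℝ → ℂ} (hL : Continuous L)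
    (h : ∀ t : ℝ, exp (L t) = c (Circle.exp t) - w)
    (hn : L (2 * Real.pi) - L 0 = 2 * (Real.pi : ℂ) * I * (n : ℂ)) (m : ℤ) (t : ℝ) :
    L (t + 2 * Real.pi * m) = L t + 2 * (Real.pi : ℂ) * I * (n * m : ℂ) := by
  have step : ∀ t, L (t + 2 * Real.pi) = L t + 2 * (Real.pi : ℂ) * I * (n : ℂ) := by
    intro t
    have := sub_eq_sub_of_exp_eq (L := fun t => L (t + 2 * Real.pi)) (M := L) (by fun_prop) hL
      (fun t => by
        have := circleExp_add_two_pi_mul_int t 1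
        simp only [Int.cast_one, mul_one] at this
        rw [h, h, this]) 0 t
    simp only [zero_add, hn] at this
    rw [← this]; ring
  induction m generalizing t with
  | zero => simp
  | succ m ih =>
    have e : t + 2 * Real.pi * ((m + 1 : ℤ) : ℝ) = (t + 2 * Real.pi * ((m : ℤ) : ℝ)) +
      2 * Real.pi := by push_cast; ring
    rw [e, step, ih]; push_cast; ring
  | pred m ih =>
    have e : t + 2 * Real.pi * ((-m : ℤ) : ℝ) = (t + 2 * Real.pi * ((-m - 1 : ℤ) : ℝ)) +
      2 * Real.pi := by push_cast; ring
    have := ih t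
    rw [e, step] at this
    rw [eq_sub_of_add_eq this]; push_cast; ring

theorem HasWindingNumber.unique {c : Circle → ℂ} {w : ℂ} {n m : ℤ} (hn : HasWindingNumber c w n)
    (hm : HasWindingNumber c w m) : n = m := by
  obtain ⟨L, hL, h, hd⟩ := hn
  obtain ⟨M, hM, h', hd'⟩ := hm
  have := sub_eq_sub_of_exp_eq hL hM (fun t => by rw [h, h']) 0 (2 * Real.pi)
  have e : 2 * (Real.pi : ℂ) * I * (n : ℂ) = 2 * (Real.pi : ℂ) * I * (m : ℂ) := by
    rw [← hd, ← hd']; linear_combination this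
  have := mul_left_cancel₀ two_pi_I_ne_zero e
  exact_mod_cast this

/-- A logarithm of a unimodular function is purely imaginary, so `(M t).im` is a real angle for `h`
and can be substituted into the logarithm `L` of `c - w`. -/
theorem HasWindingNumber.comp {c : Circle → ℂ} {w : ℂ} {n d : ℤ} (hc : HasWindingNumber c w n)
    {h : Circle → Circle} (hd : HasWindingNumber (fun x => (h x : ℂ)) 0 d) :
    HasWindingNumber (c ∘ h) w (n * d) := by
  obtain ⟨L, hL, hLe, hLn⟩ := hc
  obtain ⟨M, hM, hMe, hMd⟩ := hd
  have hre : ∀ t, (M t).re = 0 := by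
    intro t
    have := congrArg norm (hMe t)
    rw [norm_exp, sub_zero, Circle.norm_coe] at this
    simpa using this
  have hex : ∀ t, Circle.exp (M t).im = h (Circle.exp t) := by
    intro t
    ext
    rw [Circle.coe_exp, ← sub_zero (h (Circle.exp t) : ℂ), ← hMe t]
    congr 1
    apply Complex.ext <;> simp [hre]
  have him : (M (2 * Real.pi)).im = (M 0).im + 2 * Real.pi * d := by
    have := congrArg im hMd
    simp at this
    linarith
  refine ⟨fun t => L (M t).im, by fun_prop, fun t => ?_, ?_⟩
  · rw [hLe, hex]; rfl
  · show L (M (2 * Real.pi)).im - L (M 0).im = _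
    rw [him, lift_add_two_pi_mul_int hL hLe hLn]
    push_cast; ring

/-- Conjugating the plane and reversing the parameter each change the sign of the winding number,
and the symmetry `hs` identifies the two operations on `c`. -/
theorem HasWindingNumber.conj {c : Circle → ℂ} {w : ℂ} {n : ℤ}
    (hs : ∀ x, c x⁻¹ = starRingEnd ℂ (c x)) (hc : HasWindingNumber c w n) :
    HasWindingNumber c (starRingEnd ℂ w) n := by
  obtain ⟨L, hL, hLe, hLn⟩ := hc
  refine ⟨fun t => starRingEnd ℂ (L (-t)), continuous_conj.comp (by fun_prop), fun t => ?_, ?_⟩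
  · rw [exp_conj, hLe, Circle.exp_neg, map_sub, hs, conj_conj]
  · have := lift_add_two_pi_mul_int hL hLe hLn (-1) 0
    simp only [Int.cast_neg, Int.cast_one, mul_neg, mul_one, zero_add] at this
    simp only [this, neg_zero, map_add, map_mul, map_neg, conj_I, conj_ofReal, map_intCast,
      map_ofNat]
    ring

theorem hasWindingNumber_coe : HasWindingNumber (fun x => (x : ℂ)) 0 1 :=
  ⟨fun t => t * I, by fun_prop, fun t => by simp [Circle.coe_exp], by simp⟩

theorem div_mem_slitPlane {a b : ℂ} (hb : b ≠ 0)
    (h : 0 < a.re * b.re + a.im * b.im ∨ a.im * b.re - a.re * b.im ≠ 0) : a / b ∈ slitPlane := by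
  have hn : 0 < normSq b := normSq_pos.2 hb
  rw [mem_slitPlane_iff, div_re, div_im, ← add_div, ← sub_div]
  exact h.imp (fun h => div_pos h hn) (fun h => div_ne_zero h hn.ne')

/-- The two expressions are, up to a positive factor, the real and imaginary parts of `(c' - w') /
(c - w)`. This quotient stays in the slit plane, so its principal logarithm is a correction with no
increment over a period. -/
theorem HasWindingNumber.of_not_antiparallel {c c' : Circle → ℂ} {w w' : ℂ} {n : ℤ}
    (hc : HasWindingNumber c w n) (hcont : Continuous c) (hcont' : Continuous c')
    (h : ∀ x, 0 < (c' x - w').re * (c x - w).re + (c' x - w').im * (c x - w).im ∨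
      (c' x - w').im * (c x - w).re - (c' x - w').re * (c x - w).im ≠ 0) :
    HasWindingNumber c' w' n := by
  have h0 : ∀ x, c x - w ≠ 0 := by
    intro x hx
    have := h x
    simp [hx] at this
  have hs := fun x => div_mem_slitPlane (h0 x) (h x)
  obtain ⟨L, hL, hLe, hLn⟩ := hc
  refine ⟨fun t => L t + log ((c' (Circle.exp t) - w') / (c (Circle.exp t) - w)), ?_, ?_, ?_⟩
  · refine hL.add (Continuous.clog ?_ fun t => hs _)
    exact Continuous.div (by fun_prop) (by fun_prop) fun t => h0 _
  · intro t
    rw [exp_add, hLe, exp_log (slitPlane_ne_zero (hs _)), mul_div_cancel₀ _ (h0 _)]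
  · simp only [Circle.exp_two_pi, Circle.exp_zero]
    rw [← hLn]; ring

theorem hasWindingNumber_zero_of_mul_mem_slitPlane {c : Circle → ℂ} (hc : Continuous c) {w u : ℂ}
    (hu : u ≠ 0) (h : ∀ x, u * (c x - w) ∈ slitPlane) : HasWindingNumber c w 0 := by
  refine ⟨fun t => log (u * (c (Circle.exp t) - w)) - log u, ?_, ?_, ?_⟩
  · exact (Continuous.clog (by fun_prop) fun t => h _).sub continuous_const
  · intro t
    rw [exp_sub, exp_log (slitPlane_ne_zero (h _)), exp_log hu, mul_div_cancel_left₀ _ hu]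
  · simp

/-- A continuous function whose sine is nonnegative on a segment varies by at most `π` there. -/
theorem abs_sub_le_pi_of_sin_nonneg {φ : ℝ → ℝ} {a b : ℝ} (hab : a ≤ b)
    (hφ : ContinuousOn φ (Set.Icc a b)) (h : ∀ t ∈ Set.Icc a b, 0 ≤ Real.sin (φ t)) :
    |φ b - φ a| ≤ Real.pi := by
  by_contra! hlt
  have himg : Set.uIcc (φ a) (φ b) ⊆ φ '' Set.uIcc a b :=
    intermediate_value_uIcc (by rwa [Set.uIcc_of_le hab])
  rw [Set.uIcc_of_le hab] at himg
  have hpi := Real.pi_pos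
  have hM : min (φ a) (φ b) + Real.pi < max (φ a) (φ b) := by
    have := max_sub_min_eq_abs (φ a) (φ b)
    linarith
  set m := min (φ a) (φ b)
  set M := max (φ a) (φ b)
  set n := ⌊m / (2 * Real.pi)⌋
  have hn₁ : n * (2 * Real.pi) ≤ m := (le_div_iff₀ (by positivity)).1 (Int.floor_le _)
  have hn₂ : m < (n + 1) * (2 * Real.pi) := (div_lt_iff₀ (by positivity)).1 (Int.lt_floor_add_one _)
  -- The values start in the `n`-th period and span more than `π`, so they enter its second half,
  -- where the sine is negative.
  obtain ⟨y, h₁, h₂, h₃, h₄⟩ : ∃ y, m ≤ y ∧ y ≤ M ∧ n * (2 * Real.pi) + Real.pi < y ∧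
      y < n * (2 * Real.pi) + 2 * Real.pi := by
    have hlt : max m (n * (2 * Real.pi) + Real.pi) < min M (n * (2 * Real.pi) + 2 * Real.pi) :=
      max_lt (lt_min (by linarith) (by linarith)) (lt_min (by linarith) (by linarith))
    obtain ⟨y, hy₁, hy₂⟩ := exists_between hlt
    exact ⟨y, ((le_max_left _ _).trans_lt hy₁).le, (hy₂.trans_le (min_le_left _ _)).le,
      (le_max_right _ _).trans_lt hy₁, hy₂.trans_le (min_le_right _ _)⟩
  obtain ⟨t, ht, rfl⟩ := himg ⟨h₁, h₂⟩
  have hpos : 0 < Real.sin (φ t - n * (2 * Real.pi) - Real.pi) :=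
    Real.sin_pos_of_pos_of_lt_pi (by linarith) (by linarith)
  rw [Real.sin_sub_pi, Real.sin_sub_int_mul_two_pi] at hpos
  linarith [h t ht]

theorem abs_im_sub_le_pi {L : ℝ → ℂ} (hL : Continuous L) {a b : ℝ} (hab : a ≤ b)
    (h : (∀ t ∈ Set.Ioo a b, 0 ≤ (exp (L t)).im) ∨ ∀ t ∈ Set.Ioo a b, (exp (L t)).im ≤ 0) :
    |(L b).im - (L a).im| ≤ Real.pi := by
  rcases hab.eq_or_lt with rfl | hlt
  · simpa using Real.pi_pos.le
  have hc : Continuous fun t => (exp (L t)).im := by fun_prop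
  rcases h with h | h
  · refine abs_sub_le_pi_of_sin_nonneg (φ := fun t => (L t).im) hab (by fun_prop) fun t ht => ?_
    rw [← closure_Ioo hlt.ne] at ht
    have : 0 ≤ (exp (L t)).im :=
      closure_minimal (t := {t | 0 ≤ (exp (L t)).im}) h (isClosed_le continuous_const hc) ht
    rw [exp_im] at this
    exact nonneg_of_mul_nonneg_right this (Real.exp_pos _)
  · have := abs_sub_le_pi_of_sin_nonneg (φ := fun t => -(L t).im) hab (by fun_prop) fun t ht => by
      rw [← closure_Ioo hlt.ne] at ht
      have : (exp (L t)).im ≤ 0 :=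
        closure_minimal (t := {t | (exp (L t)).im ≤ 0}) h (isClosed_le hc continuous_const) ht
      rw [exp_im] at this
      rw [Real.sin_neg]
      by_contra! hneg
      nlinarith [Real.exp_pos (L t).re]
    rwa [← neg_sub_neg, abs_sub_comm, neg_neg, neg_neg, abs_sub_comm, ← abs_neg, neg_sub] at this

/-- Each of the five intervals contributes at most `π` to the change of argument, and `5π < 2π · 3`.
-/
theorem HasWindingNumber.abs_le_two {c : Circle → ℂ} {w : ℂ} {n : ℤ} (hc : HasWindingNumber c w n)
    {t₁ t₂ t₃ t₄ : ℝ} (h₁ : 0 ≤ t₁) (h₂ : t₁ ≤ t₂) (h₃ : t₂ ≤ t₃) (h₄ : t₃ ≤ t₄)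
    (h₅ : t₄ ≤ 2 * Real.pi)
    (h : ∀ I ∈ ({(0, t₁), (t₁, t₂), (t₂, t₃), (t₃, t₄), (t₄, 2 * Real.pi)} : Set (ℝ × ℝ)),
      (∀ t ∈ Set.Ioo I.1 I.2, w.im ≤ (c (Circle.exp t)).im) ∨
      ∀ t ∈ Set.Ioo I.1 I.2, (c (Circle.exp t)).im ≤ w.im) : |n| ≤ 2 := by
  obtain ⟨L, hL, hLe, hLn⟩ := hc
  have key : ∀ a b, a ≤ b → (a, b) ∈ ({(0, t₁), (t₁, t₂), (t₂, t₃), (t₃, t₄),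
      (t₄, 2 * Real.pi)} : Set (ℝ × ℝ)) → |(L b).im - (L a).im| ≤ Real.pi := by
    intro a b hab hI
    apply abs_im_sub_le_pi hL hab
    simpa [hLe] using h _ hI
  have k₁ := abs_le.1 (key _ _ h₁ (by simp))
  have k₂ := abs_le.1 (key _ _ h₂ (by simp))
  have k₃ := abs_le.1 (key _ _ h₃ (by simp))
  have k₄ := abs_le.1 (key _ _ h₄ (by simp))
  have k₅ := abs_le.1 (key _ _ h₅ (by simp))
  have him := congrArg im hLn
  simp at him
  have hpi := Real.pi_pos
  have hn : (n : ℝ) < 3 := by nlinarith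
  have hn' : (-3 : ℝ) < n := by nlinarith
  have : n < 3 := by exact_mod_cast hn
  have : -3 < n := by exact_mod_cast hn'
  rw [abs_le]; omega

end Winding

/-! ### Unimodality of the imaginary part along the upper boundary. -/

section Profile

theorem exists_threshold {P : ℝ → Prop} {a b : ℝ} (hab : a ≤ b)
    (hP : ∀ x y, a ≤ x → x < y → P y → P x) :
    ∃ c ∈ Set.Icc a b, (∀ x ∈ Set.Ico a c, P x) ∧ ∀ x ∈ Set.Ioc c b, ¬ P x := by
  -- Adjoining `a` keeps the supremum meaningful when `P` holds nowhere; nothing is claimed at the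
  -- threshold itself.
  set T : Set ℝ := {x | x = a ∨ (x ∈ Set.Icc a b ∧ P x)}
  have hbdd : BddAbove T := ⟨b, by rintro x (rfl | hx); exacts [hab, hx.1.2]⟩
  have hne : T.Nonempty := ⟨a, Or.inl rfl⟩
  have ha : a ≤ sSup T := le_csSup hbdd (Or.inl rfl)
  refine ⟨sSup T, ⟨ha, csSup_le hne ?_⟩, fun x hx => ?_, fun x hx h => ?_⟩
  · rintro x (rfl | hx)
    exacts [hab, hx.1.2]
  · obtain ⟨y, hy, hxy⟩ := exists_lt_of_lt_csSup hne hx.2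
    rcases hy with rfl | hy
    · exact absurd hx.1 hxy.not_ge
    · exact hP x y hx.1 hxy hy.2
  · exact (le_csSup hbdd (Or.inr ⟨⟨ha.trans hx.1.le, hx.2⟩, h⟩)).not_gt hx.1

/-- The imaginary part of the lens map at a boundary point `z` of the region, above the real axis,
in terms of `r = |cos z|` (or, if `|Re z| = π / 2`, of `r = boundaryRad k z.im`). -/
noncomputable def profile (k r : ℝ) : ℝ :=
  Real.arsinh √((r ^ 2 + k * r - 1) / 2) -
    √((r ^ 2 - k * r + 1) / 2) * √((r ^ 2 + k * r - 1) / 2) / r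

theorem continuousOn_profile (k : ℝ) : ContinuousOn (profile k) (Set.Ioi 0) := by
  unfold profile
  refine ContinuousOn.sub (ContinuousOn.arsinh (by fun_prop)) (ContinuousOn.div (by fun_prop) (by fun_prop) ?_)
  intro r hr
  exact (Set.mem_Ioi.1 hr).ne'

/-- The three roots stand for `sinh y`, `cosh y` and `cos x`. In this factored form only the first
factor can change sign. -/
theorem hasDerivAt_profile {k r : ℝ} (hr : 0 < r) (hp : 0 < (r ^ 2 + k * r - 1) / 2)
    (hq : 0 < (r ^ 2 - k * r + 1) / 2) :
    HasDerivAt (profile k)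
      ((r - r ^ 3 + 2 * √((r ^ 2 - k * r + 1) / 2) * √((r ^ 2 + k * r + 1) / 2)) *
        (r * √((r ^ 2 + k * r + 1) / 2) - √((r ^ 2 - k * r + 1) / 2)) /
        (4 * √((r ^ 2 + k * r - 1) / 2) * √((r ^ 2 - k * r + 1) / 2) *
          √((r ^ 2 + k * r + 1) / 2) * r ^ 2)) r := by
  have h₁ : HasDerivAt (fun r : ℝ => (r ^ 2 + k * r - 1) / 2) ((2 * r + k) / 2) r := by
    have := ((((hasDerivAt_id r).pow 2).add ((hasDerivAt_id r).const_mul k)).sub_const 1).div_const 2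
    convert! this using 1
    simp
  have h₂ : HasDerivAt (fun r : ℝ => (r ^ 2 - k * r + 1) / 2) ((2 * r - k) / 2) r := by
    have := ((((hasDerivAt_id r).pow 2).sub ((hasDerivAt_id r).const_mul k)).add_const 1).div_const 2
    convert! this using 1
    simp
  have h₃ := h₁.sqrt hp.ne'
  have h₄ := h₂.sqrt hq.ne'
  have h := h₃.arsinh.sub ((h₄.mul h₃).div (hasDerivAt_id r) hr.ne')
  refine HasDerivAt.congr_deriv h ?_
  have e : 1 + √((r ^ 2 + k * r - 1) / 2) ^ 2 = (r ^ 2 + k * r + 1) / 2 := by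
    rw [Real.sq_sqrt hp.le]; ring
  simp only [e, smul_eq_mul, Pi.mul_apply, id]
  have hB : 0 < (r ^ 2 + k * r + 1) / 2 := by linarith
  have hS2 := Real.sq_sqrt hp.le
  have hC2 := Real.sq_sqrt hq.le
  have hB2 := Real.sq_sqrt hB.le
  have hS0 := Real.sqrt_pos.2 hp
  have hC0 := Real.sqrt_pos.2 hq
  have hB0 := Real.sqrt_pos.2 hB
  generalize √((r ^ 2 + k * r - 1) / 2) = S at *
  generalize √((r ^ 2 - k * r + 1) / 2) = C at *
  generalize √((r ^ 2 + k * r + 1) / 2) = B at *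
  field_simp
  linear_combination 4 * (-B * (2 * r - k) * r + 4 * B * C ^ 2) * hS2 +
    4 * (-B * (2 * r + k) * r + 2 * B * (r ^ 2 + k * r - 1) + 2 * B) * hC2 - 8 * C * r * hB2

/-- The difference of the squares is `(r² + 1)(r² + k r - 1) / 2`. -/
theorem profile_factor_pos {k r : ℝ} (hr : 0 < r) (hp : 0 < (r ^ 2 + k * r - 1) / 2)
    (hq : 0 < (r ^ 2 - k * r + 1) / 2) :
    0 < r * √((r ^ 2 + k * r + 1) / 2) - √((r ^ 2 - k * r + 1) / 2) := by
  rw [sub_pos]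
  apply lt_of_pow_lt_pow_left₀ 2 (by positivity)
  rw [mul_pow, Real.sq_sqrt hq.le, Real.sq_sqrt (by linarith)]
  nlinarith [mul_pos hp (by positivity : 0 < r ^ 2 + 1)]

theorem monotoneOn_profile {k a b : ℝ} (ha : 0 < a)
    (hp : ∀ r ∈ Set.Ioo a b, 0 < (r ^ 2 + k * r - 1) / 2)
    (hq : ∀ r ∈ Set.Ioo a b, 0 < (r ^ 2 - k * r + 1) / 2)
    (h : ∀ r ∈ Set.Ioo a b,
      0 ≤ r - r ^ 3 + 2 * √((r ^ 2 - k * r + 1) / 2) * √((r ^ 2 + k * r + 1) / 2)) :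
    MonotoneOn (profile k) (Set.Icc a b) := by
  have hpos : ∀ r ∈ Set.Ioo a b, 0 < r := fun r hr => ha.trans hr.1
  refine monotoneOn_of_hasDerivWithinAt_nonneg (convex_Icc a b)
    ((continuousOn_profile k).mono fun r hr => ha.trans_le hr.1)
    (fun r hr => by
      rw [interior_Icc] at hr ⊢
      exact (hasDerivAt_profile (hpos r hr) (hp r hr) (hq r hr)).hasDerivWithinAt)
    fun r hr => ?_
  rw [interior_Icc] at hr
  have := (profile_factor_pos (hpos r hr) (hp r hr) (hq r hr)).le
  exact div_nonneg (mul_nonneg (h r hr) this) (by positivity)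

theorem antitoneOn_profile {k a b : ℝ} (ha : 0 < a)
    (hp : ∀ r ∈ Set.Ioo a b, 0 < (r ^ 2 + k * r - 1) / 2)
    (hq : ∀ r ∈ Set.Ioo a b, 0 < (r ^ 2 - k * r + 1) / 2)
    (h : ∀ r ∈ Set.Ioo a b,
      r - r ^ 3 + 2 * √((r ^ 2 - k * r + 1) / 2) * √((r ^ 2 + k * r + 1) / 2) ≤ 0) :
    AntitoneOn (profile k) (Set.Icc a b) := by
  have hpos : ∀ r ∈ Set.Ioo a b, 0 < r := fun r hr => ha.trans hr.1
  refine antitoneOn_of_hasDerivWithinAt_nonpos (convex_Icc a b)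
    ((continuousOn_profile k).mono fun r hr => ha.trans_le hr.1)
    (fun r hr => by
      rw [interior_Icc] at hr ⊢
      exact (hasDerivAt_profile (hpos r hr) (hp r hr) (hq r hr)).hasDerivWithinAt)
    fun r hr => ?_
  rw [interior_Icc] at hr
  have := (profile_factor_pos (hpos r hr) (hp r hr) (hq r hr)).le
  exact div_nonpos_of_nonpos_of_nonneg (mul_nonpos_of_nonpos_of_nonneg (h r hr) this)
    (by positivity)

/-- For `1 < r` its sign is the sign of the derivative of `profile k` at `r`. -/
noncomputable def cuspPoly (k r : ℝ) : ℝ :=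
  (r ^ 2 + 1) ^ 2 - k ^ 2 * r ^ 2 - r ^ 2 * (r ^ 2 - 1) ^ 2

/-- In other words `cuspPoly k r / r²` is strictly decreasing for `r ≥ 1`, so its sign changes at
most once. The quantity `key` is the cofactor of `s² - r²` in the difference of the two sides. -/
theorem cuspPoly_mul_lt {k r s : ℝ} (hr : 1 ≤ r) (hrs : r < s) :
    cuspPoly k s * r ^ 2 < cuspPoly k r * s ^ 2 := by
  have hu : 0 ≤ r ^ 2 - 1 := by nlinarith
  have huv : 0 < s ^ 2 - r ^ 2 := by nlinarith
  unfold cuspPoly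
  generalize r ^ 2 = u at *
  generalize s ^ 2 = v at *
  have key : 0 < 1 - u * v + u * v * (u + v - 2) := by
    obtain ⟨a, rfl⟩ : ∃ a, u = 1 + a := ⟨u - 1, by ring⟩
    obtain ⟨b, rfl⟩ : ∃ b, v = 1 + b := ⟨v - 1, by ring⟩
    have ha : 0 ≤ a := by linarith
    have hb : 0 < b := by linarith
    nlinarith [mul_nonneg ha hb.le, mul_nonneg (mul_nonneg ha hb.le) (add_nonneg ha hb.le),
      mul_pos hb hb, mul_nonneg ha ha]
  nlinarith [mul_pos huv key]

theorem two_mul_sqrt_mul_sqrt_sq {k r : ℝ} (hk : 0 < k) (hr : 0 < r)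
    (hq : 0 < (r ^ 2 - k * r + 1) / 2) :
    (2 * √((r ^ 2 - k * r + 1) / 2) * √((r ^ 2 + k * r + 1) / 2)) ^ 2 =
      cuspPoly k r + (r ^ 3 - r) ^ 2 := by
  rw [mul_pow, mul_pow, Real.sq_sqrt hq.le, Real.sq_sqrt (by positivity)]
  unfold cuspPoly; ring

/-- For `r ≤ 1` both parts are nonnegative. Otherwise `r³ - r` is compared with the product of roots
through their squares, which differ by `cuspPoly k r`. -/
theorem profile_deriv_factor_nonneg {k r : ℝ} (hk : 0 < k) (hr : 0 < r)
    (hq : 0 < (r ^ 2 - k * r + 1) / 2) (h : r ≤ 1 ∨ 0 ≤ cuspPoly k r) :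
    0 ≤ r - r ^ 3 + 2 * √((r ^ 2 - k * r + 1) / 2) * √((r ^ 2 + k * r + 1) / 2) := by
  have h0 : 0 ≤ 2 * √((r ^ 2 - k * r + 1) / 2) * √((r ^ 2 + k * r + 1) / 2) := by positivity
  rcases h with h | h
  · have : r ^ 3 ≤ r := pow_le_of_le_one hr.le h (by norm_num)
    linarith
  · have := two_mul_sqrt_mul_sqrt_sq hk hr hq
    have := abs_le_of_sq_le_sq' (by linarith) h0 (a := r ^ 3 - r)
    linarith [this.2]

theorem profile_deriv_factor_nonpos {k r : ℝ} (hk : 0 < k) (hr : 0 < r)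
    (hq : 0 < (r ^ 2 - k * r + 1) / 2) (h : ¬ (r ≤ 1 ∨ 0 ≤ cuspPoly k r)) :
    r - r ^ 3 + 2 * √((r ^ 2 - k * r + 1) / 2) * √((r ^ 2 + k * r + 1) / 2) ≤ 0 := by
  push Not at h
  have := two_mul_sqrt_mul_sqrt_sq hk hr hq
  have h0 : 0 ≤ r ^ 3 - r := by nlinarith [mul_pos hr (sub_pos.2 h.1)]
  have := abs_le_of_sq_le_sq' (by linarith [h.2]) h0
    (a := 2 * √((r ^ 2 - k * r + 1) / 2) * √((r ^ 2 + k * r + 1) / 2))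
  linarith [this.2]

/-- The least value of `|cos z|` on the boundary of the region. -/
noncomputable def radMin (k : ℝ) : ℝ := (√(k ^ 2 + 4) - k) / 2

/-- The greatest value of `|cos z|` on the boundary of the region. -/
noncomputable def radMax (k : ℝ) : ℝ := (√(k ^ 2 + 4) + k) / 2

theorem radMin_mul_radMax (k : ℝ) : radMin k * radMax k = 1 := by
  have := Real.sq_sqrt (by positivity : 0 ≤ k ^ 2 + 4)
  unfold radMin radMax; nlinarith

theorem radMax_sub_radMin (k : ℝ) : radMax k - radMin k = k := by
  unfold radMin radMax; ring

theorem radMax_pos {k : ℝ} (hk : 0 < k) : 0 < radMax k := by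
  unfold radMax; positivity

theorem radMin_pos {k : ℝ} (hk : 0 < k) : 0 < radMin k :=
  pos_of_mul_pos_left (by rw [radMin_mul_radMax]; exact one_pos) (radMax_pos hk).le

theorem sq_add_mul_sub_one (k r : ℝ) :
    r ^ 2 + k * r - 1 = (r - radMin k) * (r + radMax k) := by
  linear_combination -r * radMax_sub_radMin k + radMin_mul_radMax k

theorem sq_sub_mul_sub_one (k r : ℝ) :
    r ^ 2 - k * r - 1 = (r - radMax k) * (r + radMin k) := by
  linear_combination r * radMax_sub_radMin k + radMin_mul_radMax k

theorem radMin_le_radMax {k : ℝ} (hk : 0 < k) : radMin k ≤ radMax k := by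
  linarith [radMax_sub_radMin k]

/-- For `k < 2` the derivative formula holds throughout and the peak is where its sign changes. For
`k ≥ 2` there is a middle range with `|Re z| = π/2`, where the profile is just `y` and increases;
the peak is at the upper end of that range. -/
theorem profile_unimodal {k : ℝ} (hk : 0 < k) :
    ∃ c ∈ Set.Icc (radMin k) (radMax k), MonotoneOn (profile k) (Set.Icc (radMin k) c) ∧
      AntitoneOn (profile k) (Set.Icc c (radMax k)) := by
  have h0 := radMin_pos hk
  have h1 := radMax_pos hk
  have hp : ∀ r, radMin k < r → 0 < (r ^ 2 + k * r - 1) / 2 := by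
    intro r hr
    rw [sq_add_mul_sub_one]
    have := mul_pos (sub_pos.2 hr) (by linarith : 0 < r + radMax k)
    linarith
  rcases lt_or_ge k 2 with h2 | h2
  · have hq : ∀ r, 0 < (r ^ 2 - k * r + 1) / 2 := by
      intro r; nlinarith [sq_nonneg (r - k / 2)]
    obtain ⟨c, hc, hc₁, hc₂⟩ := exists_threshold (P := fun r => r ≤ 1 ∨ 0 ≤ cuspPoly k r)
      (radMin_le_radMax hk) (by
        intro r s hr hrs h
        rw [or_iff_not_imp_left, not_le]
        intro h1r
        have hs : 0 ≤ cuspPoly k s := h.resolve_left (by linarith)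
        have := cuspPoly_mul_lt (k := k) h1r.le hrs
        have h' : 0 < cuspPoly k r * s ^ 2 := this.trans_le' (by positivity)
        exact (pos_of_mul_pos_left h' (by positivity)).le)
    refine ⟨c, hc, monotoneOn_profile h0 (fun r hr => hp r hr.1) (fun r _ => hq r)
      fun r hr => profile_deriv_factor_nonneg hk (h0.trans hr.1) (hq r) (hc₁ r ⟨hr.1.le, hr.2⟩),
      antitoneOn_profile (h0.trans_le hc.1) (fun r hr => hp r (hc.1.trans_lt hr.1))
      (fun r _ => hq r) fun r hr => profile_deriv_factor_nonpos hk
        (h0.trans (hc.1.trans_lt hr.1)) (hq r) (hc₂ r ⟨hr.1, hr.2.le⟩)⟩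
  -- `c` and `c⁻¹` are the roots of `r² - k r + 1`. Between them this quadratic is nonpositive, and
  -- the truncated square root gives the correct value `cos x = 0`.
  · obtain ⟨c, hc1, hcr, hcmax⟩ : ∃ c, 1 ≤ c ∧ c ^ 2 - k * c + 1 = 0 ∧ c ≤ radMax k := by
      have hs := Real.sq_sqrt (by nlinarith : 0 ≤ k ^ 2 - 4)
      have hs0 := Real.sqrt_nonneg (k ^ 2 - 4)
      refine ⟨(k + √(k ^ 2 - 4)) / 2, by linarith, by nlinarith, ?_⟩
      have : √(k ^ 2 - 4) ≤ √(k ^ 2 + 4) := Real.sqrt_le_sqrt (by linarith)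
      unfold radMax; linarith
    have hc0 : 0 < c := by linarith
    have hcc : c⁻¹ ≤ 1 := inv_le_one_of_one_le₀ hc1
    have hci : radMin k ≤ c⁻¹ := by
      rw [le_inv_comm₀ h0 hc0]
      rwa [inv_eq_of_mul_eq_one_right (radMin_mul_radMax k)]
    have hfac : ∀ r, r ^ 2 - k * r + 1 = (r - c) * (r - c⁻¹) := by
      intro r
      field_simp
      linear_combination r * hcr
    refine ⟨c, ⟨hci.trans (hcc.trans hc1), hcmax⟩, ?_, ?_⟩
    · rw [← Set.Icc_union_Icc_eq_Icc hci (hcc.trans hc1)]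
      refine MonotoneOn.union_right (c := c⁻¹) ?_ ?_ ⟨⟨hci, le_rfl⟩, fun r hr => hr.2⟩
        ⟨⟨le_rfl, hcc.trans hc1⟩, fun r hr => hr.1⟩
      · have hq : ∀ r ∈ Set.Ioo (radMin k) c⁻¹, 0 < (r ^ 2 - k * r + 1) / 2 := by
          intro r hr
          rw [hfac]
          have := mul_pos_of_neg_of_neg (by linarith [hr.2] : r - c < 0) (sub_neg.2 hr.2)
          linarith
        exact monotoneOn_profile h0 (fun r hr => hp r hr.1) hq fun r hr =>
          profile_deriv_factor_nonneg hk (h0.trans hr.1) (hq r hr) (Or.inl (hr.2.le.trans hcc))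
      · have hV : ∀ r ∈ Set.Icc c⁻¹ c, profile k r = Real.arsinh √((r ^ 2 + k * r - 1) / 2) := by
          intro r hr
          have : √((r ^ 2 - k * r + 1) / 2) = 0 := by
            rw [Real.sqrt_eq_zero', hfac]
            have := mul_nonpos_of_nonpos_of_nonneg (sub_nonpos.2 hr.2) (sub_nonneg.2 hr.1)
            linarith
          simp [profile, this]
        intro r hr s hs hrs
        rw [hV r hr, hV s hs, Real.arsinh_le_arsinh]
        apply Real.sqrt_le_sqrt
        have : 0 < r := (inv_pos.2 hc0).trans_le hr.1
        gcongr
    · have hq : ∀ r ∈ Set.Ioo c (radMax k), 0 < (r ^ 2 - k * r + 1) / 2 := by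
        intro r hr
        rw [hfac]
        have := mul_pos (sub_pos.2 hr.1) (by linarith [hr.1] : 0 < r - c⁻¹)
        linarith
      refine antitoneOn_profile hc0
        (fun r hr => hp r ((hci.trans (hcc.trans hc1)).trans_lt hr.1)) hq fun r hr =>
        profile_deriv_factor_nonpos hk (hc0.trans hr.1) (hq r hr) ?_
      push Not
      refine ⟨hc1.trans_lt hr.1, ?_⟩
      have h := cuspPoly_mul_lt (k := k) hc1 hr.1
      -- At the root `c` the first two terms of `cuspPoly` cancel.
      have hc' : cuspPoly k c ≤ 0 := by
        have : (c ^ 2 + 1) ^ 2 = k ^ 2 * c ^ 2 := by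
          linear_combination (c ^ 2 + k * c + 1) * hcr
        unfold cuspPoly
        nlinarith [mul_nonneg (sq_nonneg c) (sq_nonneg (c ^ 2 - 1))]
      have : cuspPoly k r * c ^ 2 < 0 :=
        h.trans_le (mul_nonpos_of_nonpos_of_nonneg hc' (sq_nonneg _))
      exact neg_of_mul_neg_left this (sq_nonneg c)

end Profile

/-! ### The region and its boundary curve. -/

section Region

open Complex

theorem det_sub_conj_mul (a : ℂ) (f : ℂ →L[ℝ] ℂ) (hf : ∀ v, f v = v - starRingEnd ℂ (a * v)) :
    f.det = 1 - normSq a := by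
  have : f.det = LinearMap.det (f : ℂ →ₗ[ℝ] ℂ) := rfl
  rw [this, ← LinearMap.det_toMatrix basisOneI, Matrix.det_fin_two]
  simp [LinearMap.toMatrix_apply, hf, normSq_apply]
  ring

theorem normSq_sin (z : ℂ) : normSq (sin z) = Real.sin z.re ^ 2 + Real.sinh z.im ^ 2 := by
  have e : sin z = ⟨Real.sin z.re * Real.cosh z.im, Real.cos z.re * Real.sinh z.im⟩ := by
    rw [sin_eq, mk_eq_add_mul_I]; push_cast; ring
  rw [e, normSq_mk]
  have h1 := Real.cosh_sq z.im
  have h2 := Real.cos_sq' z.re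
  linear_combination Real.sin z.re ^ 2 * h1 + Real.sinh z.im ^ 2 * h2

theorem normSq_cos (z : ℂ) : normSq (cos z) = Real.cos z.re ^ 2 + Real.sinh z.im ^ 2 := by
  have e : cos z = ⟨Real.cos z.re * Real.cosh z.im, -(Real.sin z.re * Real.sinh z.im)⟩ := by
    rw [cos_eq, mk_eq_add_mul_I]; push_cast; ring
  rw [e, normSq_mk]
  have h1 := Real.cosh_sq z.im
  have h2 := Real.cos_sq' z.re
  linear_combination Real.cos z.re ^ 2 * h1 + Real.sinh z.im ^ 2 * h2

theorem lensMap_eq_sub_conj (k : ℝ) (z : ℂ) :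
    lensMap k z = z - starRingEnd ℂ ((k : ℂ) / sin z) := by
  rw [lensMap, sin_conj, map_div₀, conj_ofReal]

theorem lensMap_conj (k : ℝ) (z : ℂ) :
    lensMap k (starRingEnd ℂ z) = starRingEnd ℂ (lensMap k z) := by
  simp only [lensMap_eq_sub_conj, sin_conj, map_sub, map_div₀, conj_ofReal, conj_conj]

theorem lensMap_im (k : ℝ) (z : ℂ) : (lensMap k z).im =
    z.im - k * (Real.cos z.re * Real.sinh z.im) / (Real.sin z.re ^ 2 + Real.sinh z.im ^ 2) := by
  have e : (sin z).im = Real.cos z.re * Real.sinh z.im := by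
    have : sin z = ⟨Real.sin z.re * Real.cosh z.im, Real.cos z.re * Real.sinh z.im⟩ := by
      rw [sin_eq, mk_eq_add_mul_I]; push_cast; ring
    rw [this]
  rw [lensMap_eq_sub_conj, sub_im, conj_im, div_im, normSq_sin, e]
  simp

theorem lensJacobian_eq (k : ℝ) {z : ℂ} (hz : sin z ≠ 0) :
    lensJacobian k z = 1 - k ^ 2 * normSq (cos z) / normSq (sin z) ^ 2 := by
  have h₁ : HasDerivAt (fun z => (k : ℂ) / sin z) (-(k * cos z) / sin z ^ 2) z := by
    have := (hasDerivAt_const z (k : ℂ)).div (hasDerivAt_sin z) hz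
    rw [zero_mul, zero_sub] at this
    exact this
  have h₂ := (hasFDerivAt_id z).sub
    (conjCLE.toContinuousLinearMap.hasFDerivAt.comp z (h₁.hasFDerivAt.restrictScalars ℝ))
  have h₃ : HasFDerivAt (lensMap k) _ z := h₂.congr_of_eventuallyEq
    (Filter.Eventually.of_forall fun z => by simp [lensMap_eq_sub_conj])
  rw [lensJacobian, h₃.fderiv, det_sub_conj_mul (-(k * cos z) / sin z ^ 2)]
  · simp [normSq_ofReal, pow_two]
  · intro v
    simp [mul_comm]

/-- At a boundary point `z` of the region with `|Re z| < π / 2`, the value of `|cos z|` as a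
function of the imaginary part of `z`. -/
noncomputable def boundaryRad (k y : ℝ) : ℝ := (√(k ^ 2 + 4 + 8 * Real.sinh y ^ 2) - k) / 2

/-- Half the width of the region at a given imaginary part. -/
noncomputable def halfWidth (k y : ℝ) : ℝ :=
  Real.arcsin √((k * boundaryRad k y - boundaryRad k y ^ 2 + 1) / 2)

/-- The largest imaginary part of a point in the closure of the region. -/
noncomputable def halfHeight (k : ℝ) : ℝ := Real.arsinh √(k * radMax k)

theorem boundaryRad_eq (k y : ℝ) :
    boundaryRad k y ^ 2 + k * boundaryRad k y - 1 = 2 * Real.sinh y ^ 2 := by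
  have := Real.sq_sqrt (by positivity : 0 ≤ k ^ 2 + 4 + 8 * Real.sinh y ^ 2)
  unfold boundaryRad; linear_combination this / 4

theorem continuous_boundaryRad (k : ℝ) : Continuous (boundaryRad k) := by
  unfold boundaryRad
  have := Real.continuous_sinh
  fun_prop

theorem continuous_halfWidth (k : ℝ) : Continuous (halfWidth k) := by
  have := continuous_boundaryRad k
  unfold halfWidth
  exact Real.continuous_arcsin.comp (by fun_prop)

theorem boundaryRad_pos (k y : ℝ) : 0 < boundaryRad k y := by
  have : k < √(k ^ 2 + 4 + 8 * Real.sinh y ^ 2) := by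
    apply Real.lt_sqrt_of_sq_lt
    nlinarith [sq_nonneg (Real.sinh y)]
  unfold boundaryRad; linarith

theorem halfWidth_neg (k y : ℝ) : halfWidth k (-y) = halfWidth k y := by
  simp [halfWidth, boundaryRad]

theorem halfWidth_nonneg (k y : ℝ) : 0 ≤ halfWidth k y :=
  Real.arcsin_nonneg.2 (Real.sqrt_nonneg _)

theorem halfWidth_le (k y : ℝ) : halfWidth k y ≤ Real.pi / 2 := Real.arcsin_le_pi_div_two _

theorem boundaryRad_le_iff {k x y : ℝ} :
    boundaryRad k x ≤ boundaryRad k y ↔ |x| ≤ |y| := by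
  have h : ∀ x y, |x| ≤ |y| ↔ √(k ^ 2 + 4 + 8 * Real.sinh x ^ 2) ≤
      √(k ^ 2 + 4 + 8 * Real.sinh y ^ 2) := by
    intro x y
    rw [Real.sqrt_le_sqrt_iff (by positivity), ← Real.sinh_le_sinh, ← Real.abs_sinh,
      ← Real.abs_sinh, ← sq_le_sq]
    constructor <;> intro h <;> linarith
  rw [h]
  unfold boundaryRad
  constructor <;> intro h <;> linarith

theorem boundaryRad_zero (k : ℝ) : boundaryRad k 0 = radMin k := by
  simp [boundaryRad, radMin]

theorem halfHeight_pos {k : ℝ} (hk : 0 < k) : 0 < halfHeight k :=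
  Real.arsinh_pos_iff.2 (Real.sqrt_pos.2 (mul_pos hk (radMax_pos hk)))

theorem boundaryRad_halfHeight {k : ℝ} (hk : 0 < k) :
    boundaryRad k (halfHeight k) = radMax k := by
  have hM := radMax_pos hk
  have h1 := sq_sub_mul_sub_one k (radMax k)
  rw [sub_self, zero_mul] at h1
  have e : k ^ 2 + 4 + 8 * Real.sinh (halfHeight k) ^ 2 = (2 * radMax k + k) ^ 2 := by
    rw [halfHeight, Real.sinh_arsinh, Real.sq_sqrt (by positivity)]
    linear_combination -4 * h1
  rw [boundaryRad, e, Real.sqrt_sq (by positivity)]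
  ring

theorem boundaryRad_le_radMax {k y : ℝ} (hk : 0 < k) :
    boundaryRad k y ≤ radMax k ↔ |y| ≤ halfHeight k := by
  rw [← boundaryRad_halfHeight hk, boundaryRad_le_iff, abs_of_pos (halfHeight_pos hk)]

theorem halfWidth_pos_iff {k y : ℝ} (hk : 0 < k) : 0 < halfWidth k y ↔ |y| < halfHeight k := by
  have e : (k * boundaryRad k y - boundaryRad k y ^ 2 + 1) / 2 =
      (radMax k - boundaryRad k y) * (boundaryRad k y + radMin k) / 2 := by
    linear_combination -sq_sub_mul_sub_one k (boundaryRad k y) / 2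
  have hs : 0 < boundaryRad k y + radMin k := add_pos (boundaryRad_pos k y) (radMin_pos hk)
  rw [halfWidth, Real.arcsin_pos, Real.sqrt_pos, e, ← not_le, ← not_le, not_iff_not,
    ← abs_of_pos (halfHeight_pos hk), ← boundaryRad_le_iff, boundaryRad_halfHeight hk]
  constructor
  · intro h
    by_contra! hlt
    nlinarith [mul_pos (sub_pos.2 hlt) hs]
  · intro h
    nlinarith [mul_nonneg (sub_nonneg.2 h) hs.le]

theorem halfWidth_eq_zero {k y : ℝ} (hk : 0 < k) (hy : halfHeight k ≤ |y|) :
    halfWidth k y = 0 :=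
  le_antisymm (not_lt.1 fun h => ((halfWidth_pos_iff hk).1 h).not_ge hy) (halfWidth_nonneg k y)

theorem sin_ne_zero_of_abs_re_le {z : ℂ} (hz : |z.re| ≤ Real.pi / 2) (h0 : z ≠ 0) :
    sin z ≠ 0 := by
  intro h
  have h1 := normSq_sin z
  rw [h, map_zero] at h1
  have h2 : Real.sin z.re = 0 := by
    have : Real.sin z.re ^ 2 = 0 := by
      nlinarith [sq_nonneg (Real.sin z.re), sq_nonneg (Real.sinh z.im)]
    simpa using this
  have h3 : z.im = 0 := by
    have : Real.sinh z.im ^ 2 = 0 := by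
      nlinarith [sq_nonneg (Real.sin z.re), sq_nonneg (Real.sinh z.im)]
    simpa using this
  have hpi := Real.pi_pos
  have := abs_le.1 hz
  have h4 : z.re = 0 := (Real.sin_eq_zero_iff_of_lt_of_lt (by linarith) (by linarith)).1 h2
  exact h0 (Complex.ext h4 h3)

theorem mem_negRegion_iff {k : ℝ} (hk : 0 < k) (z : ℂ) :
    z ∈ negRegion k ↔ |z.re| < Real.pi / 2 ∧
      normSq (sin z) ^ 2 < k ^ 2 * normSq (cos z) := by
  unfold negRegion
  refine and_congr_right fun hz => ?_
  by_cases h0 : z = 0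
  · subst h0; simp [hk]
  · have hs := sin_ne_zero_of_abs_re_le hz.le h0
    have : 0 < normSq (sin z) ^ 2 := by have := normSq_pos.2 hs; positivity
    simp only [h0, false_or, lensJacobian_eq k hs]
    rw [sub_neg, one_lt_div this]

/-- For fixed `y` the condition `J < 0` is a quadratic inequality in `sin² x` with one relevant
root. If that root exceeds `1`, `arcsin` truncates to `π/2`, which is the edge of the strip. -/
theorem negRegion_eq {k : ℝ} (hk : 0 < k) :
    negRegion k = {z : ℂ | |z.re| < halfWidth k z.im} := by
  ext z
  rw [mem_negRegion_iff hk, Set.mem_ofPred_eq]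
  have key : |z.re| < Real.pi / 2 → (normSq (sin z) ^ 2 < k ^ 2 * normSq (cos z) ↔
      |z.re| < halfWidth k z.im) := by
    intro hz
    have hz' := abs_lt.1 hz
    rw [halfWidth, Real.lt_arcsin_iff_sin_lt' ⟨by linarith [Real.pi_pos, abs_nonneg z.re], hz⟩,
      Real.lt_sqrt (Real.sin_nonneg_of_nonneg_of_le_pi (abs_nonneg _)
        (by linarith [Real.pi_pos])),
      ← sq_abs (Real.sin _), Real.abs_sin_eq_sin_abs_of_abs_le_pi
        (by rw [abs_abs]; linarith [Real.pi_pos]), abs_abs,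
      ← Real.abs_sin_eq_sin_abs_of_abs_le_pi (by linarith [Real.pi_pos]), sq_abs,
      normSq_sin, normSq_cos, Real.cos_sq']
    have ht := boundaryRad_eq k z.im
    have hr := boundaryRad_pos k z.im
    generalize boundaryRad k z.im = r at *
    have h1 := sq_nonneg (Real.sin z.re)
    have h2 := sq_nonneg (Real.sinh z.im)
    generalize Real.sin z.re ^ 2 = a at *
    generalize Real.sinh z.im ^ 2 = t at *
    -- The relevant root is the one with `|sin z|² = k r`; the other factor is positive.
    have hfac : (a + t) ^ 2 - k ^ 2 * (1 - a + t) =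
        (a - (k * r - r ^ 2 + 1) / 2) * (a + t + k * r + k ^ 2) := by
      have : t = (r ^ 2 + k * r - 1) / 2 := by linarith
      subst this; ring
    have hpos : 0 < a + t + k * r + k ^ 2 := by positivity
    constructor
    · intro h
      by_contra! hle
      nlinarith [mul_nonneg (sub_nonneg.2 hle) hpos.le]
    · intro h
      nlinarith [mul_pos (sub_pos.2 h) hpos]
  constructor
  · rintro ⟨h1, h2⟩
    exact (key h1).1 h2
  · intro h
    have h1 := h.trans_le (halfWidth_le k z.im)
    exact ⟨h1, (key h1).2 h⟩

theorem isOpen_negRegion {k : ℝ} (hk : 0 < k) : IsOpen (negRegion k) := by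
  rw [negRegion_eq hk]
  have := continuous_halfWidth k
  exact isOpen_lt (by fun_prop) (by fun_prop)

theorem closure_negRegion {k : ℝ} (hk : 0 < k) :
    closure (negRegion k) = {z : ℂ | |z.re| ≤ halfWidth k z.im ∧ |z.im| ≤ halfHeight k} := by
  have hX := continuous_halfWidth k
  rw [negRegion_eq hk]
  apply subset_antisymm
  · have h₁ : IsClosed {z : ℂ | |z.re| ≤ halfWidth k z.im} :=
      isClosed_le (by fun_prop) (by fun_prop)
    have h₂ : IsClosed {z : ℂ | |z.im| ≤ halfHeight k} := isClosed_le (by fun_prop) (by fun_prop)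
    refine closure_minimal (fun z hz => ⟨le_of_lt hz, ?_⟩) (h₁.inter h₂)
    exact ((halfWidth_pos_iff hk).1 ((abs_nonneg _).trans_lt hz)).le
  · rintro z ⟨h1, h2⟩
    have hcl : (1 : ℝ) ∈ closure (Set.Ico (0 : ℝ) 1) := by
      rw [closure_Ico (by norm_num)]; exact ⟨by norm_num, le_rfl⟩
    rcases h2.lt_or_eq with h2 | h2
    -- Away from the top and bottom points a horizontal contraction moves the point into the region.
    -- At those two points the width is zero, so the contraction is towards `0` instead.
    · have := map_mem_closure (f := fun s : ℝ => (s * z.re : ℂ) + z.im * I) (by fun_prop) hcl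
        (t := {z : ℂ | |z.re| < halfWidth k z.im}) (by
          intro s hs
          have hp := (halfWidth_pos_iff hk).2 h2
          have : |s * z.re| < halfWidth k z.im := by
            rw [abs_mul, abs_of_nonneg hs.1]
            nlinarith [abs_nonneg z.re, hs.1, hs.2, mul_le_mul_of_nonneg_left h1 hs.1]
          simpa using this)
      simpa using this
    · have h0 : z.re = 0 := by
        rw [halfWidth_eq_zero hk h2.ge] at h1
        exact abs_nonpos_iff.1 h1
      have := map_mem_closure (f := fun s : ℝ => (s * z : ℂ)) (by fun_prop) hcl
        (t := {z : ℂ | |z.re| < halfWidth k z.im}) (by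
          intro s hs
          have : 0 < halfWidth k (s * z.im) := by
            rw [halfWidth_pos_iff hk, abs_mul, h2, abs_of_nonneg hs.1]
            nlinarith [halfHeight_pos hk, hs.2]
          simpa [h0] using this)
      simpa using this

theorem frontier_negRegion {k : ℝ} (hk : 0 < k) :
    frontier (negRegion k) = {z : ℂ | |z.re| = halfWidth k z.im ∧ |z.im| ≤ halfHeight k} := by
  rw [(isOpen_negRegion hk).frontier_eq, closure_negRegion hk, negRegion_eq hk]
  ext z
  simp only [Set.mem_sdiff, Set.mem_ofPred_eq, not_lt]
  constructor
  · rintro ⟨⟨h1, h2⟩, h3⟩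
    exact ⟨le_antisymm h1 h3, h2⟩
  · rintro ⟨h1, h2⟩
    exact ⟨⟨h1.le, h2⟩, h1.ge⟩

/-- The boundary of the region as a Jordan curve. -/
noncomputable def boundaryCurve (k : ℝ) (x : Circle) : ℂ :=
  ⟨if 0 ≤ (x : ℂ).re then halfWidth k (halfHeight k * (x : ℂ).im)
    else -halfWidth k (halfHeight k * (x : ℂ).im), halfHeight k * (x : ℂ).im⟩

theorem circle_re_sq_add_im_sq (x : Circle) : (x : ℂ).re ^ 2 + (x : ℂ).im ^ 2 = 1 := by
  have := x.normSq_coe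
  rw [normSq_apply] at this
  linarith

theorem abs_circle_im_le (x : Circle) : |(x : ℂ).im| ≤ 1 :=
  (abs_im_le_norm (x : ℂ)).trans_eq x.norm_coe

/-- The two branches meet where the real part vanishes, at the top and bottom points, and the half
width is zero there. -/
theorem continuous_boundaryCurve {k : ℝ} (hk : 0 < k) : Continuous (boundaryCurve k) := by
  have hX := continuous_halfWidth k
  have h : Continuous fun x : Circle => if 0 ≤ (x : ℂ).re then
      halfWidth k (halfHeight k * (x : ℂ).im) else -halfWidth k (halfHeight k * (x : ℂ).im) := by
    refine Continuous.if_le (by fun_prop) (by fun_prop) (by fun_prop) (by fun_prop) fun x hx => ?_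
    have h1 := circle_re_sq_add_im_sq x
    rw [← hx] at h1
    have h2 : |(x : ℂ).im| = 1 := by
      rw [← sq_eq_sq₀ (abs_nonneg _) zero_le_one, sq_abs]; linarith
    rw [halfWidth_eq_zero hk, neg_zero]
    rw [abs_mul, h2, mul_one]; exact le_abs_self _
  have : boundaryCurve k = fun x : Circle => ((if 0 ≤ (x : ℂ).re then
      halfWidth k (halfHeight k * (x : ℂ).im)
      else -halfWidth k (halfHeight k * (x : ℂ).im) : ℝ) : ℂ) +
      ((halfHeight k * (x : ℂ).im : ℝ) : ℂ) * I := by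
    funext x; exact mk_eq_add_mul_I _ _
  rw [this]
  exact (continuous_ofReal.comp h).add (by fun_prop)

theorem abs_boundaryCurve_re (k : ℝ) (x : Circle) :
    |(boundaryCurve k x).re| = halfWidth k (boundaryCurve k x).im := by
  have := halfWidth_nonneg k (halfHeight k * (x : ℂ).im)
  unfold boundaryCurve
  dsimp only
  split_ifs
  · exact abs_of_nonneg this
  · rw [abs_neg, abs_of_nonneg this]

theorem halfWidth_mul_im_pos {k : ℝ} (hk : 0 < k) {x : Circle} (hx : (x : ℂ).re ≠ 0) :
    0 < halfWidth k (halfHeight k * (x : ℂ).im) := by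
  rw [halfWidth_pos_iff hk, abs_mul, abs_of_pos (halfHeight_pos hk)]
  refine mul_lt_of_lt_one_right (halfHeight_pos hk) ?_
  rw [← sq_lt_one_iff₀ (abs_nonneg _), sq_abs]
  have := circle_re_sq_add_im_sq x
  have : 0 < (x : ℂ).re ^ 2 := by positivity
  linarith

theorem injective_boundaryCurve {k : ℝ} (hk : 0 < k) : Function.Injective (boundaryCurve k) := by
  intro x y hxy
  have him : (x : ℂ).im = (y : ℂ).im :=
    mul_left_cancel₀ (halfHeight_pos hk).ne' (congrArg im hxy)
  have hre : (x : ℂ).re ^ 2 = (y : ℂ).re ^ 2 := by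
    have h1 := circle_re_sq_add_im_sq x
    have h2 := circle_re_sq_add_im_sq y
    rw [him] at h1; linarith
  have hre' := congrArg re hxy
  simp only [boundaryCurve, him] at hre'
  refine Circle.ext (Complex.ext ?_ him)
  rcases sq_eq_sq_iff_eq_or_eq_neg.1 hre with h | h
  · exact h
  · by_cases h0 : (y : ℂ).re = 0
    · rw [h, h0, neg_zero]
    · have hp := halfWidth_mul_im_pos hk h0
      rw [h] at hre'
      rcases lt_or_gt_of_ne h0 with h1 | h1
      · rw [if_pos (by linarith), if_neg (by linarith)] at hre'; linarith
      · rw [if_neg (by linarith), if_pos h1.le] at hre'; linarith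

theorem range_boundaryCurve {k : ℝ} (hk : 0 < k) :
    Set.range (boundaryCurve k) = frontier (negRegion k) := by
  have hY := halfHeight_pos hk
  rw [frontier_negRegion hk]
  apply subset_antisymm
  · rintro _ ⟨x, rfl⟩
    refine ⟨abs_boundaryCurve_re k x, ?_⟩
    have := abs_circle_im_le x
    simp only [boundaryCurve, abs_mul, abs_of_pos hY]
    exact mul_le_of_le_one_right hY.le this
  · rintro z ⟨h1, h2⟩
    set q := z.im / halfHeight k
    have hq : q ^ 2 ≤ 1 := by
      rw [sq_le_one_iff_abs_le_one, abs_div, abs_of_pos hY]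
      exact (div_le_one hY).2 h2
    have hzq : halfHeight k * q = z.im := mul_div_cancel₀ _ hY.ne'
    have hsq := Real.sq_sqrt (sub_nonneg.2 hq)
    have hmem : ∀ p : ℝ, p ^ 2 = 1 - q ^ 2 → (⟨p, q⟩ : ℂ) ∈ Submonoid.unitSphere ℂ := by
      intro p hp
      refine mem_sphere_zero_iff_norm.2 ?_
      rw [← sq_eq_sq₀ (norm_nonneg _) zero_le_one, ← normSq_eq_norm_sq,
        normSq_mk]
      linarith
    rcases le_or_gt 0 z.re with h | h
    · refine ⟨⟨⟨√(1 - q ^ 2), q⟩, hmem _ hsq⟩, Complex.ext ?_ hzq⟩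
      simp only [boundaryCurve, hzq, ← h1, abs_of_nonneg h]
      exact if_pos (Real.sqrt_nonneg _)
    · have hpos : 0 < √(1 - q ^ 2) := by
        have hw : 0 < halfWidth k z.im := by rw [← h1]; exact abs_pos.2 h.ne
        rw [halfWidth_pos_iff hk] at hw
        rw [Real.sqrt_pos, sub_pos, sq_lt_one_iff_abs_lt_one, abs_div, abs_of_pos hY]
        exact (div_lt_one hY).2 hw
      refine ⟨⟨⟨-√(1 - q ^ 2), q⟩, hmem _ (by rw [neg_sq, hsq])⟩, Complex.ext ?_ hzq⟩
      simp only [boundaryCurve, hzq, ← h1, abs_of_neg h, neg_neg]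
      exact if_neg (by simpa using hpos)

/-- The comparison is with the unit circle about `q * I`, where `q` is the rescaled height of `z`:
imaginary parts always agree in sign, and where they vanish the real parts do too. -/
theorem hasWindingNumber_boundaryCurve_of_mem {k : ℝ} (hk : 0 < k) {z : ℂ}
    (hz : z ∈ negRegion k) : HasWindingNumber (boundaryCurve k) z 1 := by
  have hY := halfHeight_pos hk
  rw [negRegion_eq hk, Set.mem_ofPred_eq] at hz
  have hzY : |z.im| < halfHeight k := (halfWidth_pos_iff hk).1 ((abs_nonneg _).trans_lt hz)
  set q := z.im / halfHeight k
  have hq : |q| < 1 := by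
    rw [abs_div, abs_of_pos hY]; exact (div_lt_one hY).2 hzY
  have hzq : z.im = halfHeight k * q := (mul_div_cancel₀ _ hY.ne').symm
  have h₁ : HasWindingNumber (fun x : Circle => (x : ℂ)) (q * I) 1 := by
    refine hasWindingNumber_coe.of_not_antiparallel (by fun_prop) (by fun_prop) fun x => Or.inl ?_
    have h1 := circle_re_sq_add_im_sq x
    have h2 : |q * (x : ℂ).im| < 1 := by
      rw [abs_mul]
      exact mul_lt_one_of_nonneg_of_lt_one_left (abs_nonneg _) hq (abs_circle_im_le x)
    have := (abs_lt.1 h2).2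
    simp
    nlinarith
  refine h₁.of_not_antiparallel (by fun_prop) (continuous_boundaryCurve hk) fun x => ?_
  have him : (boundaryCurve k x - z).im = halfHeight k * ((x : ℂ).im - q) := by
    simp only [boundaryCurve, sub_im, hzq]; ring
  have e1 : ((x : ℂ) - q * I).re = (x : ℂ).re := by simp
  have e2 : ((x : ℂ) - q * I).im = (x : ℂ).im - q := by simp
  rw [him, e1, e2]
  have hre : (x : ℂ).im = q → 0 < (boundaryCurve k x - z).re * (x : ℂ).re := by
    intro h
    have h1 := circle_re_sq_add_im_sq x
    have h3 := (sq_lt_one_iff_abs_lt_one q).2 hq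
    have hz' := abs_lt.1 hz
    simp only [boundaryCurve, sub_re, h, ← hzq]
    split_ifs with h0
    · refine mul_pos (by linarith) (h0.lt_of_ne fun h0 => ?_)
      rw [← h0, h] at h1; linarith
    · exact mul_pos_of_neg_of_neg (by linarith) (not_le.1 h0)
  by_cases h : (x : ℂ).im = q
  · left
    simpa [h] using hre h
  · by_contra! hcon
    have h0 : (x : ℂ).im - q ≠ 0 := sub_ne_zero.2 h
    have hA : (boundaryCurve k x - z).re = halfHeight k * (x : ℂ).re :=
      mul_right_cancel₀ h0 (by linear_combination -hcon.2)
    rw [hA] at hcon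
    nlinarith [mul_pos hY (sq_pos_of_ne_zero h0), mul_nonneg hY.le (sq_nonneg (x : ℂ).re), hcon.1]

/-- The curve misses a ray from `z` pointing away from the region; multiplication by `u` turns that
ray into the negative real axis. -/
theorem hasWindingNumber_boundaryCurve_of_notMem {k : ℝ} (hk : 0 < k) {z : ℂ}
    (hz : z ∉ closure (negRegion k)) : HasWindingNumber (boundaryCurve k) z 0 := by
  have hY := halfHeight_pos hk
  rw [closure_negRegion hk, Set.mem_ofPred_eq, not_and_or, not_le, not_le, or_comm] at hz
  have hc := continuous_boundaryCurve hk
  have him : ∀ x, |(boundaryCurve k x).im| ≤ halfHeight k := by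
    intro x
    have : boundaryCurve k x ∈ frontier (negRegion k) := by
      rw [← range_boundaryCurve hk]; exact ⟨x, rfl⟩
    rw [frontier_negRegion hk] at this
    exact this.2
  have hre : ∀ x, (boundaryCurve k x).im - z.im = 0 → |(boundaryCurve k x).re| = halfWidth k z.im := by
    intro x hx
    rw [abs_boundaryCurve_re, sub_eq_zero.1 hx]
  rcases hz with hz | hz
  · rcases lt_abs.1 hz with h | h
    · refine hasWindingNumber_zero_of_mul_mem_slitPlane hc I_ne_zero fun x => ?_
      left
      simpa using (le_abs_self _).trans_lt ((him x).trans_lt h)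
    · refine hasWindingNumber_zero_of_mul_mem_slitPlane hc (neg_ne_zero.2 I_ne_zero) fun x => ?_
      left
      have := (neg_le_abs _).trans (him x)
      simp
      linarith
  · rcases lt_abs.1 hz with h | h
    · refine hasWindingNumber_zero_of_mul_mem_slitPlane hc (neg_ne_zero.2 one_ne_zero) fun x => ?_
      by_cases h0 : (boundaryCurve k x).im - z.im = 0
      · left
        have := (le_abs_self _).trans (hre x h0).le
        simp
        linarith
      · right
        simp only [neg_mul, one_mul, neg_im, sub_im]
        exact neg_ne_zero.2 h0
    · refine hasWindingNumber_zero_of_mul_mem_slitPlane hc one_ne_zero fun x => ?_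
      by_cases h0 : (boundaryCurve k x).im - z.im = 0
      · left
        have := (neg_le_abs _).trans (hre x h0).le
        simp
        linarith
      · right
        simpa only [one_mul, sub_im]

theorem isOrientedBoundary_boundaryCurve {k : ℝ} (hk : 0 < k) :
    IsOrientedBoundary (negRegion k) (fun _ : Fin 1 => boundaryCurve k) where
  continuous _ := continuous_boundaryCurve hk
  injective _ := injective_boundaryCurve hk
  disjoint i j h := absurd (Subsingleton.elim i j) h
  union := by rw [Set.iUnion_const, range_boundaryCurve hk]
  inside z hz := ⟨fun _ => 1, fun _ => hasWindingNumber_boundaryCurve_of_mem hk hz, by simp⟩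
  outside z hz := ⟨fun _ => 0, fun _ => hasWindingNumber_boundaryCurve_of_notMem hk hz, by simp⟩

end Region

/-! ### The image of the boundary curve. -/

section Image

open Complex

theorem sinh_le_mul_cosh {x : ℝ} (hx : 0 ≤ x) : Real.sinh x ≤ x * Real.cosh x := by
  rcases hx.eq_or_lt with rfl | hx
  · simp
  obtain ⟨ξ, hξ, h⟩ := exists_deriv_eq_slope Real.sinh hx Real.continuous_sinh.continuousOn
    Real.differentiable_sinh.differentiableOn
  rw [Real.deriv_sinh, Real.sinh_zero, sub_zero, sub_zero, eq_div_iff hx.ne'] at h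
  have : Real.cosh ξ ≤ Real.cosh x := by
    rw [Real.cosh_le_cosh, abs_of_pos hξ.1, abs_of_pos hx]; exact hξ.2.le
  rw [← h, mul_comm]
  exact mul_le_mul_of_nonneg_left this hx.le

theorem profile_radMin (k : ℝ) : profile k (radMin k) = 0 := by
  simp [profile, sq_add_mul_sub_one]

/-- The value is `t - tanh t` with `cosh t = radMax k`. -/
theorem profile_radMax_nonneg {k : ℝ} (hk : 0 < k) : 0 ≤ profile k (radMax k) := by
  have hM := radMax_pos hk
  have h1 := sq_sub_mul_sub_one k (radMax k)
  rw [sub_self, zero_mul] at h1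
  have e1 : (radMax k ^ 2 - k * radMax k + 1) / 2 = 1 := by linarith
  have e2 : (radMax k ^ 2 + k * radMax k - 1) / 2 = radMax k ^ 2 - 1 := by linarith
  have hS : 0 ≤ radMax k ^ 2 - 1 := by nlinarith
  rw [profile, e1, e2, Real.sqrt_one, one_mul, sub_nonneg, div_le_iff₀ hM]
  have h := sinh_le_mul_cosh (Real.arsinh_nonneg_iff.2 (Real.sqrt_nonneg (radMax k ^ 2 - 1)))
  rwa [Real.sinh_arsinh, Real.cosh_arsinh, Real.sq_sqrt hS, add_sub_cancel, Real.sqrt_sq hM.le] at h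

/-- On the free part of the boundary `|sin z|² = k r`, so `k` cancels; on the edge of the strip `cos
x = 0` removes the fraction on both sides. -/
theorem lensMap_im_eq_profile {k : ℝ} (hk : 0 < k) {z : ℂ} (hz : z ∈ frontier (negRegion k))
    (h0 : 0 ≤ z.im) : (lensMap k z).im = profile k (boundaryRad k z.im) := by
  rw [frontier_negRegion hk] at hz
  obtain ⟨h1, h2⟩ := hz
  have hr := boundaryRad_pos k z.im
  have ht := boundaryRad_eq k z.im
  have hle := (boundaryRad_le_radMax hk).2 h2
  have hs : 0 ≤ (k * boundaryRad k z.im - boundaryRad k z.im ^ 2 + 1) / 2 := by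
    have e := sq_sub_mul_sub_one k (boundaryRad k z.im)
    have := mul_nonpos_of_nonpos_of_nonneg (sub_nonpos.2 hle)
      (add_pos hr (radMin_pos hk)).le
    linarith
  have hcos : Real.cos z.re =
      √((boundaryRad k z.im ^ 2 - k * boundaryRad k z.im + 1) / 2) := by
    rw [← Real.cos_abs, h1, halfWidth, Real.cos_arcsin, Real.sq_sqrt hs]
    congr 1; ring
  have hsin : Real.sin z.re ^ 2 = 1 - Real.cos z.re ^ 2 := Real.sin_sq _
  have hS : √((boundaryRad k z.im ^ 2 + k * boundaryRad k z.im - 1) / 2) = Real.sinh z.im := by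
    rw [ht, mul_div_cancel_left₀ _ two_ne_zero, Real.sqrt_sq (Real.sinh_nonneg_iff.2 h0)]
  rw [lensMap_im, profile, hS, Real.arsinh_sinh, hsin, hcos]
  congr 1
  rcases le_or_gt ((boundaryRad k z.im ^ 2 - k * boundaryRad k z.im + 1) / 2) 0 with h | h
  · rw [Real.sqrt_eq_zero'.2 h]; simp
  · rw [Real.sq_sqrt h.le]
    have : 1 - (boundaryRad k z.im ^ 2 - k * boundaryRad k z.im + 1) / 2 + Real.sinh z.im ^ 2 =
      k * boundaryRad k z.im := by linarith
    rw [this, mul_div_mul_left _ _ hk.ne']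

theorem exists_level_partition {v : ℝ → ℝ} {m Y : ℝ} (hm : m ∈ Set.Icc 0 Y)
    (h₁ : MonotoneOn v (Set.Icc 0 m)) (h₂ : AntitoneOn v (Set.Icc m Y)) (l : ℝ) :
    ∃ a b, 0 ≤ a ∧ a ≤ b ∧ b ≤ Y ∧ (∀ y ∈ Set.Ico 0 a, v y ≤ l) ∧
      (∀ y ∈ Set.Ioo a b, l ≤ v y) ∧ ∀ y ∈ Set.Ioc b Y, v y ≤ l := by
  obtain ⟨a, ha, ha₁, ha₂⟩ := exists_threshold (P := fun y => y ≤ m ∧ v y < l) hm.1 (by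
    rintro x y hx hxy ⟨hy, hvy⟩
    exact ⟨hxy.le.trans hy, (h₁ ⟨hx, hxy.le.trans hy⟩ ⟨hx.trans hxy.le, hy⟩ hxy.le).trans_lt hvy⟩)
  obtain ⟨b, hb, hb₁, hb₂⟩ := exists_threshold (P := fun y => y ≤ Y ∧ l ≤ v y) hm.2 (by
    rintro x y hx hxy ⟨hy, hvy⟩
    exact ⟨hxy.le.trans hy, hvy.trans (h₂ ⟨hx, hxy.le.trans hy⟩ ⟨hx.trans hxy.le, hy⟩ hxy.le)⟩)
  refine ⟨a, b, ha.1, ha.2.trans hb.1, hb.2, fun y hy => (ha₁ y hy).2.le, fun y hy => ?_,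
    fun y hy => ?_⟩
  · rcases le_or_gt y m with h | h
    · have := ha₂ y ⟨hy.1, h⟩
      exact not_lt.1 fun h' => this ⟨h, h'⟩
    · exact (hb₁ y ⟨h.le, hy.2⟩).2
  · have := hb₂ y hy
    exact (not_le.1 fun h' => this ⟨hy.2, h'⟩).le

theorem boundary_profile_unimodal {k : ℝ} (hk : 0 < k) : ∃ m ∈ Set.Icc 0 (halfHeight k),
    MonotoneOn (fun y => profile k (boundaryRad k y)) (Set.Icc 0 m) ∧
      AntitoneOn (fun y => profile k (boundaryRad k y)) (Set.Icc m (halfHeight k)) := by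
  obtain ⟨c, hc, h₁, h₂⟩ := profile_unimodal hk
  have hmono : ∀ {x y}, 0 ≤ x → x ≤ y → boundaryRad k x ≤ boundaryRad k y := by
    intro x y hx hxy
    rwa [boundaryRad_le_iff, abs_of_nonneg hx, abs_of_nonneg (hx.trans hxy)]
  obtain ⟨m, hm, rfl⟩ := intermediate_value_Icc (halfHeight_pos hk).le
    (continuous_boundaryRad k).continuousOn (by rwa [boundaryRad_zero, boundaryRad_halfHeight hk])
  rw [← boundaryRad_zero] at h₁
  rw [← boundaryRad_halfHeight hk] at h₂
  have hm0 := hm.1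
  refine ⟨m, hm, fun x hx y hy hxy => ?_, fun x hx y hy hxy => ?_⟩
  · exact h₁ ⟨hmono le_rfl hx.1, hmono hx.1 hx.2⟩ ⟨hmono le_rfl hy.1, hmono hy.1 hy.2⟩
      (hmono hx.1 hxy)
  · exact h₂ ⟨hmono hm0 hx.1, hmono (hm0.trans hx.1) hx.2⟩
      ⟨hmono hm0 hy.1, hmono (hm0.trans hy.1) hy.2⟩ (hmono (hm0.trans hx.1) hxy)

theorem boundary_profile_nonneg {k y : ℝ} (hk : 0 < k) (hy : y ∈ Set.Icc 0 (halfHeight k)) :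
    0 ≤ profile k (boundaryRad k y) := by
  obtain ⟨m, hm, h₁, h₂⟩ := boundary_profile_unimodal hk
  rcases le_total y m with h | h
  · have := h₁ ⟨le_rfl, hm.1⟩ ⟨hy.1, h⟩ hy.1
    simpa [boundaryRad_zero, profile_radMin] using this
  · have := h₂ ⟨h, hy.2⟩ ⟨hm.2, le_rfl⟩ hy.2
    simp only [boundaryRad_halfHeight hk] at this
    exact (profile_radMax_nonneg hk).trans this

theorem boundaryCurve_mem_frontier {k : ℝ} (hk : 0 < k) (x : Circle) :
    boundaryCurve k x ∈ frontier (negRegion k) := by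
  rw [← range_boundaryCurve hk]; exact ⟨x, rfl⟩

theorem lensMap_boundaryCurve_im {k : ℝ} (hk : 0 < k) {x : Circle} (hx : 0 ≤ (x : ℂ).im) :
    (lensMap k (boundaryCurve k x)).im =
      profile k (boundaryRad k (halfHeight k * (x : ℂ).im)) :=
  lensMap_im_eq_profile hk (boundaryCurve_mem_frontier hk x) (mul_nonneg (halfHeight_pos hk).le hx)

theorem lensMap_boundaryCurve_inv (k : ℝ) (x : Circle) :
    lensMap k (boundaryCurve k x⁻¹) = starRingEnd ℂ (lensMap k (boundaryCurve k x)) := by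
  rw [← lensMap_conj]
  congr 1
  apply Complex.ext <;> simp [boundaryCurve, halfWidth_neg]

theorem continuous_lensMap_boundaryCurve {k : ℝ} (hk : 0 < k) :
    Continuous (lensMap k ∘ boundaryCurve k) := by
  have hc := continuous_boundaryCurve hk
  have hne : ∀ x, sin (starRingEnd ℂ (boundaryCurve k x)) ≠ 0 := by
    intro x
    rw [sin_conj]
    refine (map_ne_zero _).2 (sin_ne_zero_of_abs_re_le ?_ fun h => ?_)
    · rw [abs_boundaryCurve_re]; exact halfWidth_le _ _
    · have := abs_boundaryCurve_re k x
      rw [h, zero_re, zero_im, abs_zero] at this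
      exact ((halfWidth_pos_iff (y := 0) hk).2 (by simpa using halfHeight_pos hk)).ne this
  unfold lensMap
  refine hc.sub (continuous_const.div ?_ hne)
  exact continuous_sin.comp (continuous_conj.comp hc)

theorem circle_exp_im (t : ℝ) : (Circle.exp t : ℂ).im = Real.sin t := by
  rw [Circle.coe_exp, exp_ofReal_mul_I_im]

theorem abs_windingNumber_lensMap_boundaryCurve_le {k : ℝ} (hk : 0 < k) {w : ℂ} {n : ℤ}
    (h : HasWindingNumber (lensMap k ∘ boundaryCurve k) w n) : |n| ≤ 2 := by
  -- The image curve is symmetric in the real axis, so `w` may be conjugated.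
  wlog hw : 0 ≤ w.im generalizing w
  · exact this (h.conj (lensMap_boundaryCurve_inv k)) (by rw [conj_im]; linarith)
  have hY := halfHeight_pos hk
  have hpi := Real.pi_pos
  obtain ⟨m, hm, h₁, h₂⟩ := boundary_profile_unimodal hk
  obtain ⟨a, b, ha, hab, hb, hl, hu, hr⟩ := exists_level_partition hm h₁ h₂ w.im
  have him : ∀ t, 0 ≤ Real.sin t → ((lensMap k ∘ boundaryCurve k) (Circle.exp t)).im =
      profile k (boundaryRad k (halfHeight k * Real.sin t)) := by
    intro t ht
    rw [← circle_exp_im] at ht ⊢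
    exact lensMap_boundaryCurve_im hk ht
  have him' : ∀ t, Real.sin t ≤ 0 →
      ((lensMap k ∘ boundaryCurve k) (Circle.exp t)).im ≤ w.im := by
    intro t ht
    have h1 := lensMap_boundaryCurve_inv k (Circle.exp t)
    rw [← Circle.exp_neg] at h1
    have h2 := congrArg im h1
    rw [conj_im, ← Function.comp_apply (f := lensMap k), him (-t) (by rw [Real.sin_neg]; linarith)]
      at h2
    have := boundary_profile_nonneg hk (y := halfHeight k * Real.sin (-t))
      ⟨mul_nonneg hY.le (by rw [Real.sin_neg]; linarith),
        mul_le_of_le_one_right hY.le (Real.sin_le_one _)⟩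
    rw [Function.comp_apply]
    linarith
  -- `α` and `β` are the parameters in the first quadrant at which the boundary curve has heights
  -- `a` and `b`; left-right symmetry gives the other two cuts, `π - β` and `π - α`.
  obtain ⟨α, hα, hα', hαs⟩ : ∃ α, 0 ≤ α ∧ α ≤ Real.pi / 2 ∧ halfHeight k * Real.sin α = a := by
    have h1 : a / halfHeight k ≤ 1 := (div_le_one hY).2 (hab.trans hb)
    have h0 : 0 ≤ a / halfHeight k := div_nonneg ha hY.le
    exact ⟨Real.arcsin (a / halfHeight k), Real.arcsin_nonneg.2 h0, Real.arcsin_le_pi_div_two _,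
      by rw [Real.sin_arcsin (by linarith) h1, mul_div_cancel₀ _ hY.ne']⟩
  obtain ⟨β, hβ, hβ', hβs⟩ : ∃ β, 0 ≤ β ∧ β ≤ Real.pi / 2 ∧ halfHeight k * Real.sin β = b := by
    have h1 : b / halfHeight k ≤ 1 := (div_le_one hY).2 hb
    have h0 : 0 ≤ b / halfHeight k := div_nonneg (ha.trans hab) hY.le
    exact ⟨Real.arcsin (b / halfHeight k), Real.arcsin_nonneg.2 h0, Real.arcsin_le_pi_div_two _,
      by rw [Real.sin_arcsin (by linarith) h1, mul_div_cancel₀ _ hY.ne']⟩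
  have hsin : ∀ {s t}, 0 ≤ s → s < t → t ≤ Real.pi / 2 →
      halfHeight k * Real.sin s < halfHeight k * Real.sin t := fun hs hst ht =>
    mul_lt_mul_of_pos_left (Real.sin_lt_sin_of_lt_of_le_pi_div_two (by linarith) ht hst) hY
  have hαβ : α ≤ β := by
    by_contra! hlt
    have := hsin hβ hlt hα'
    rw [hαs, hβs] at this
    linarith
  have low : ∀ t, 0 ≤ t → t < α → profile k (boundaryRad k (halfHeight k * Real.sin t)) ≤ w.im :=
    fun t h0 ht => hl _ ⟨mul_nonneg hY.le (Real.sin_nonneg_of_nonneg_of_le_pi h0 (by linarith)),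
      hαs ▸ hsin h0 ht hα'⟩
  have mid : ∀ t, α < t → t < β → w.im ≤ profile k (boundaryRad k (halfHeight k * Real.sin t)) :=
    fun t h0 ht => hu _ ⟨hαs ▸ hsin hα h0 (by linarith), hβs ▸ hsin (by linarith) ht hβ'⟩
  have top : ∀ t, β < t → t ≤ Real.pi / 2 →
      profile k (boundaryRad k (halfHeight k * Real.sin t)) ≤ w.im :=
    fun t h0 ht => hr _ ⟨hβs ▸ hsin hβ h0 ht, mul_le_of_le_one_right hY.le (Real.sin_le_one _)⟩
  refine h.abs_le_two hα hαβ (by linarith : β ≤ Real.pi - β) (by linarith : _ ≤ Real.pi - α)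
    (by linarith) ?_
  rintro I (rfl | rfl | rfl | rfl | rfl)
  · right
    intro t ht
    dsimp only at ht
    rw [him t (Real.sin_nonneg_of_nonneg_of_le_pi ht.1.le (by linarith [ht.2]))]
    exact low t ht.1.le ht.2
  · left
    intro t ht
    dsimp only at ht
    rw [him t (Real.sin_nonneg_of_nonneg_of_le_pi (by linarith [ht.1]) (by linarith [ht.2]))]
    exact mid t ht.1 ht.2
  · right
    intro t ht
    dsimp only at ht
    rw [him t (Real.sin_nonneg_of_nonneg_of_le_pi (by linarith [ht.1]) (by linarith [ht.2]))]
    rcases le_total t (Real.pi / 2) with h | h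
    · exact top t ht.1 h
    · rw [← Real.sin_pi_sub]
      exact top _ (by linarith [ht.2]) (by linarith)
  · left
    intro t ht
    dsimp only at ht
    rw [him t (Real.sin_nonneg_of_nonneg_of_le_pi (by linarith [ht.1]) (by linarith [ht.2])),
      ← Real.sin_pi_sub]
    exact mid _ (by linarith [ht.2]) (by linarith [ht.1])
  -- The last arc joins the remaining low piece to the whole lower half, where the imaginary part is
  -- at most `0 ≤ w.im`.
  · right
    intro t ht
    dsimp only at ht
    rcases le_total t Real.pi with h | h
    · rw [him t (Real.sin_nonneg_of_nonneg_of_le_pi (by linarith [ht.1]) h), ← Real.sin_pi_sub]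
      exact low _ (by linarith) (by linarith [ht.1])
    · refine him' t ?_
      have := Real.sin_nonneg_of_nonneg_of_le_pi (x := t - Real.pi) (by linarith)
        (by linarith [ht.2])
      rw [Real.sin_sub_pi] at this
      linarith

/-- A closed curve running in a Jordan curve is a continuous reparametrization of it. -/
theorem exists_continuous_comp_eq {X : Type*} [TopologicalSpace X] {γ : Circle → ℂ}
    {c : X → ℂ} (hγ : Continuous γ) (hinj : Function.Injective γ) (hc : Continuous c)
    (h : Set.range c ⊆ Set.range γ) : ∃ p : X → Circle, Continuous p ∧ γ ∘ p = c := by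
  have hemb := (hγ.isClosedEmbedding hinj).isEmbedding
  let e := hemb.toHomeomorph
  have hmem : ∀ x, c x ∈ Set.range γ := fun x => h ⟨x, rfl⟩
  refine ⟨fun x => e.symm ⟨c x, hmem x⟩, by fun_prop, funext fun x => ?_⟩
  exact congrArg Subtype.val (e.apply_symm_apply ⟨c x, hmem x⟩)

end Image

theorem proposition1 (k : ℝ) (hk : 0 < k) :
    (∃ (m : ℕ) (c : Fin m → Circle → ℂ), IsOrientedBoundary (negRegion k) c) ∧
    ∀ (m : ℕ) (c : Fin m → Circle → ℂ), IsOrientedBoundary (negRegion k) c →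
      ∀ w : ℂ, w ∉ lensMap k '' frontier (negRegion k) →
        ∃ N : ℤ, HasTotalWindingNumber (fun i => lensMap k ∘ c i) w N ∧ |N| ≤ 2 := by
  refine ⟨⟨1, _, isOrientedBoundary_boundaryCurve hk⟩, fun m c hc w hw => ?_⟩
  have hγ := continuous_boundaryCurve hk
  have h0 : (0 : ℂ) ∈ negRegion k := ⟨by simp [Real.pi_pos], Or.inl rfl⟩
  obtain ⟨N, hN⟩ := exists_hasWindingNumber (continuous_lensMap_boundaryCurve hk) (w := w)
    fun x hx => hw ⟨_, boundaryCurve_mem_frontier hk x, hx⟩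
  refine ⟨N, ?_, abs_windingNumber_lensMap_boundaryCurve_le hk hN⟩
  have hp : ∀ i, ∃ p : Circle → Circle, Continuous p ∧ boundaryCurve k ∘ p = c i := fun i =>
    exists_continuous_comp_eq hγ (injective_boundaryCurve hk) (hc.continuous i) (by
      rw [range_boundaryCurve hk, ← hc.union]
      exact Set.subset_iUnion (fun i => Set.range (c i)) i)
  choose p hpc hpe using hp
  have hd : ∀ i, ∃ d, HasWindingNumber (fun x => (p i x : ℂ)) 0 d := fun i =>
    exists_hasWindingNumber (by have := hpc i; fun_prop) fun x => (p i x).coe_ne_zero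
  choose d hd using hd
  -- Winding numbers about the interior point `0` detect the degrees `d i`, since `boundaryCurve k`
  -- winds once about it; hence the degrees add up to `1`.
  obtain ⟨n, hn, hsum⟩ := hc.inside 0 h0
  have hnd : ∀ i, n i = d i := by
    intro i
    have := (hasWindingNumber_boundaryCurve_of_mem hk h0).comp (hd i)
    rw [hpe, one_mul] at this
    exact (hn i).unique this
  refine ⟨fun i => N * d i, fun i => ?_, ?_⟩
  · have := hN.comp (hd i)
    rwa [Function.comp_assoc, hpe] at this
  · rw [← Finset.mul_sum, ← Finset.sum_congr rfl fun i _ => hnd i, hsum, mul_one]
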